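/- Let $X$ be a compact connected Hausdorff complex manifold of dimension $k$, and let $F$ be a holomorphic correspondence on $X$, i.e. a formal sum $\Gamma=\sum_{j=1}^N m_j\Gamma_j$ ($N\ge 1$, $m_j$ positive integers) of distinct irreducible complex analytic subvarieties $\Gamma_j\subset X\times X$ of dimension $k$ such that both coordinate projections $\pi_1,\pi_2$ map each $\Gamma_j$ onto $X$ and have finite fibres on $|\Gamma|=\bigcup_j\Gamma_j$. For $A\subseteq X$ put $F^{\dagger}(A)=\pi_1(\pi_2^{-1}(A)\cap|\Gamma|)$. A point $w\in F^{\dagger}(z)=F^\dagger(\{z\})$ is counted with multiplicity $\sum_j m_j\,\nu_j(w,z)$, where $\nu_j(w,z)$ is the local multiplicity of $\pi_2|_{\Gamma_j}$ at $(w,z)$, i.e. the number of points of $\Gamma_j$ near $(w,z)$ lying over a generic point near $z$ ($\nu_j(w,z)=0$ if $(w,z)\notin\Gamma_j$); sums over the points of $F^\dagger(z)$ repeated according to multiplicity are written $\sum'_{w\in F^\dagger(z)}$. Let $d$ be the topological degree of $F$, i.e. the number of points of $F^\dagger(z)$, counted with multiplicity, for generic $z\in X$. For $\phi:X\to\mathbb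 R$ let $$(U_F\phi)(z)=\frac1d\sum_{w\in F^\dagger(z)}{}^{'}\ \phi(w).$$ Let $\mu$ be a Borel probability measure on $X$ that is $F^*$-invariant, i.e. $\int_X\sum'_{w\in F^\dagger(z)}\phi(w)\,d\mu(z)=d\int_X\phi\,d\mu$ for every continuous $\phi:X\to\mathbb R$. Write $I(\phi)=\int_X\phi\,d\mu$ and $I_n(\phi,\psi)=\int_X (U_F^n\phi)\,\psi\,d\mu$. With respect to $\mu$, the correspondence $F$ is called * *mixing* if $\lim_{n\to\infty}I_n(\phi,\psi)=I(\phi)I(\psi)$ for all $\phi\in C(X,\mathbb R)$ and $\psi\in L^1(\mu)$; * *weakly mixing* if $\lim_{n\to\infty}\frac1n\sum_{j=0}^{n-1}|I_j(\phi,\psi)-I(\phi)I(\psi)|=0$ for all $\phi\in C(X,\mathbb R)$ and $\psi\in L^1(\mu)$; * *ergodic* if $\mu(B)\in\{0,1\}$ for every Borel set $B$ that is almost invariant, meaning that there is a Borel set $B'\subseteq B$ with $\mu(B')=\mu(B)$ and $F^\dagger(B')\subseteq B$. Then, with respect to $\mu$: if $F$ is mixing, then $F$ is weakly mixing; and if $F$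 is weakly mixing, then $F$ is ergodic. -/

import Mathlib

open Set Filter Topology MeasureTheory
open scoped Manifold ContDiff

noncomputable section

namespace HolCorr

section AnalyticSets

variable {E : Type*} [NormedAddCommGroup E] [NormedSpace ℂ E]
  {H : Type*} [TopologicalSpace H] (I : ModelWithCorners ℂ E H)
  {M : Type*} [TopologicalSpace M] [ChartedSpace H M]

/-- `S` is a complex analytic subset (complex subvariety) of the complex manifold `M`: near every
point of `M` it is the common zero set of finitely many holomorphic functions. -/
def IsAnalyticSubset (S : Set M) : Prop :=
  ∀ p : M, ∃ U : Set M, IsOpen U ∧ p ∈ U ∧ ∃ (n : ℕ) (f : Fin n → M → ℂ),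
    (∀ i, MDifferentiableOn I 𝓘(ℂ, ℂ) (f i) U) ∧ ∀ x ∈ U, (x ∈ S ↔ ∀ i, f i x = 0)

/-- `S` is an irreducible complex analytic subset of `M`: it is non-empty and is not the union of
two strictly smaller analytic subsets. -/
def IsIrreducibleAnalytic (S : Set M) : Prop :=
  IsAnalyticSubset I S ∧ S.Nonempty ∧
    ∀ A B : Set M, IsAnalyticSubset I A → IsAnalyticSubset I B → S = A ∪ B → S = A ∨ S = B

/-- `p` is a regular point of `S` at which `S` has dimension `r`: some holomorphic chart of `M`
around `p` straightens `S` to a complex linear subspace of dimension `r`. -/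
def IsRegularPoint (S : Set M) (p : M) (r : ℕ) : Prop :=
  p ∈ S ∧ ∃ e ∈ IsManifold.maximalAtlas I ω M, p ∈ e.source ∧
    ∃ W : Submodule ℂ E, Module.finrank ℂ W = r ∧ ∀ x ∈ e.source, (x ∈ S ↔ I (e x) ∈ W)

/-- The analytic set `S` has dimension `r`: this is the largest dimension of `S` at a
regular point. -/
def HasDimension (S : Set M) (r : ℕ) : Prop :=
  IsGreatest {s : ℕ | ∃ p, IsRegularPoint I S p s} r

end AnalyticSets

section LocalMultiplicity

variable {X : Type*} [TopologicalSpace X]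

/-- The property defining the local multiplicity at `p` of the restriction to `S` of the second
projection `X × X → X`: for every sufficiently small neighbourhood `U` of `p`, a generic point `z`
near `p.2` has exactly `m` preimages in `S ∩ U`. -/
def IsLocalMult (S : Set (X × X)) (p : X × X) (m : ℕ) : Prop :=
  ∃ U₀ ∈ 𝓝 p, ∀ U ∈ 𝓝 p, U ⊆ U₀ →
    ∀ᶠ z in 𝓝 p.2 ⊓ residual X, {w : X | (w, z) ∈ S ∩ U}.ncard = m

open Classical in
/-- The local multiplicity at `p` of the second projection restricted to `S`. It is `0` when `p`
does not belong to the closed set `S`. -/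
def localMult (S : Set (X × X)) (p : X × X) : ℕ :=
  if h : ∃ m, IsLocalMult S p m then h.choose else 0

end LocalMultiplicity

/-- A holomorphic correspondence on the complex manifold `X` of dimension `k`: a formal sum
`∑ j, m j • Γ j` of distinct irreducible `k`-dimensional complex subvarieties of `X × X`, with
positive integer coefficients, such that both projections are surjective on each `Γ j` and have
finite fibres on the union of the `Γ j`. -/
structure HolomorphicCorrespondence (k : ℕ) (X : Type*) [TopologicalSpace X]
    [ChartedSpace (EuclideanSpace ℂ (Fin k)) X] where
  N : ℕ
  N_pos : 0 < N
  Γ : Fin N → Set (X × X)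
  m : Fin N → ℕ
  m_pos : ∀ j, 0 < m j
  distinct : Function.Injective Γ
  irreducible : ∀ j, IsIrreducibleAnalytic
    (𝓘(ℂ, EuclideanSpace ℂ (Fin k)).prod 𝓘(ℂ, EuclideanSpace ℂ (Fin k))) (Γ j)
  dimension : ∀ j, HasDimension
    (𝓘(ℂ, EuclideanSpace ℂ (Fin k)).prod 𝓘(ℂ, EuclideanSpace ℂ (Fin k))) (Γ j) k
  surj_fst : ∀ j, Prod.fst '' Γ j = univ
  surj_snd : ∀ j, Prod.snd '' Γ j = univ
  finite_image : ∀ z : X, (⋃ j, Prod.snd '' (Prod.fst ⁻¹' {z} ∩ Γ j)).Finite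
  finite_preimage : ∀ z : X, (⋃ j, Prod.fst '' (Prod.snd ⁻¹' {z} ∩ Γ j)).Finite

namespace HolomorphicCorrespondence

variable {k : ℕ} {X : Type*} [TopologicalSpace X] [ChartedSpace (EuclideanSpace ℂ (Fin k)) X]
  (F : HolomorphicCorrespondence k X)

/-- The support `|Γ|`, the union of the components. -/
def support : Set (X × X) := ⋃ j, F.Γ j

/-- The preimage `F†(A)` of a set. -/
def preimage (A : Set X) : Set X := Prod.fst '' (Prod.snd ⁻¹' A ∩ F.support)

/-- The multiplicity with which the point `w` occurs in `F†(z)`. -/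
def mult (w z : X) : ℕ := ∑ j, F.m j * localMult (F.Γ j) (w, z)

/-- The sum of `φ w` over the points `w` of `F†(z)`, repeated according to multiplicity. -/
def preimageSum (φ : X → ℝ) (z : X) : ℝ := ∑ᶠ w ∈ F.preimage {z}, (F.mult w z : ℝ) * φ w

/-- `d` is the number of points of `F†(z)` for generic `z`, each component `Γ j` being counted
`m j` times. -/
def IsTopologicalDegree (d : ℕ) : Prop :=
  ∀ᶠ z in residual X, ∑ j, F.m j * {w : X | (w, z) ∈ F.Γ j}.ncard = d

open Classical in
/-- The topological degree of the correspondence. -/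
def topologicalDegree : ℕ :=
  if h : ∃ d, F.IsTopologicalDegree d then h.choose else 0

/-- The Koopman operator `U_F`. -/
def koopman (φ : X → ℝ) : X → ℝ :=
  fun z => (1 / (F.topologicalDegree : ℝ)) * F.preimageSum φ z

variable [MeasurableSpace X] (μ : Measure X)

/-- `F^* μ = d μ`, tested on continuous functions. -/
def IsInvariant : Prop :=
  ∀ φ : C(X, ℝ), ∫ z, F.preimageSum φ z ∂μ = (F.topologicalDegree : ℝ) * ∫ z, φ z ∂μ

/-- The integral of `(U_F^n φ) ψ`. -/
def correlation (n : ℕ) (φ ψ : X → ℝ) : ℝ := ∫ z, (F.koopman^[n] φ) z * ψ z ∂μ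

/-- `F` is mixing with respect to `μ`. -/
def Mixing : Prop :=
  ∀ (φ : C(X, ℝ)) (ψ : X → ℝ), Integrable ψ μ →
    Tendsto (fun n : ℕ => F.correlation μ n φ ψ) atTop (𝓝 ((∫ z, φ z ∂μ) * ∫ z, ψ z ∂μ))

/-- `F` is weakly mixing with respect to `μ`. -/
def WeaklyMixing : Prop :=
  ∀ (φ : C(X, ℝ)) (ψ : X → ℝ), Integrable ψ μ →
    Tendsto (fun n : ℕ => (1 / (n : ℝ)) * ∑ j ∈ Finset.range n,
      |F.correlation μ j φ ψ - (∫ z, φ z ∂μ) * ∫ z, ψ z ∂μ|) atTop (𝓝 0)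

/-- The Borel set `B` is almost invariant with respect to `F` and `μ`. -/
def AlmostInvariant (B : Set X) : Prop :=
  MeasurableSet B ∧ ∃ B' : Set X, MeasurableSet B' ∧ B' ⊆ B ∧ μ B = μ B' ∧ F.preimage B' ⊆ B

/-- `F` is ergodic with respect to `μ`. -/
def Ergodic : Prop := ∀ B : Set X, F.AlmostInvariant μ B → μ B = 0 ∨ μ B = 1

end HolomorphicCorrespondence

end HolCorr

end

/-! Mixing gives weak mixing because Cesàro means of a null sequence are null. For ergodicity, write
`U_F φ (z)` as the integral of `φ` against the transition measure `κ_z`, the normalised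
multiplicities on `F†(z)`; invariance says that `κ` carries `μ` to itself. If `B` is almost
invariant, then `κ_z` lives on `B` for a.e. `z ∈ B`, so the image `ν` of `μ|B` lives on `B` and `ν ≤
μ|B`. Weak mixing forces the masses to agree, so `ν = μ|B` and `∫_B U_F^n φ = ∫_B φ` for all `n`.
Weak mixing then gives `μ|B = μ(B) μ`, and evaluating at `B` yields `μ(B) = μ(B)²`
(`measure_eq_zero_or_one_of_weakMixing`). Neither `κ_z(X) = 1` nor measurability in `z` is taken
from the geometry of `F`: both substitutes come from weak mixing and invariance. -/

open ProbabilityTheory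
open scoped ENNReal NNReal BoundedContinuousFunction

namespace HolCorr

/-! ### Measurability of measure-valued maps, tested on continuous functions. -/

section MeasureValued

variable {α Y : Type*} [MeasurableSpace α] [TopologicalSpace Y] [MeasurableSpace Y] [BorelSpace Y]
  {μ : Measure α} {κ : α → Measure Y}

/-- The Borel sets of a second countable space are generated by a countable `π`-system of closed
sets containing the whole space. -/
theorem exists_countable_piSystem_isClosed [SecondCountableTopology Y] :
    ∃ S : Set (Set Y), S.Countable ∧ IsPiSystem S ∧ univ ∈ S ∧ (∀ s ∈ S, IsClosed s) ∧
      ‹MeasurableSpace Y› = MeasurableSpace.generateFrom S := by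
  obtain ⟨b, hbc, -, hb⟩ := TopologicalSpace.exists_countable_basis Y
  have hcl : ∀ t ⊆ compl '' b, IsClosed (⋂₀ t) := fun t ht => isClosed_sInter fun s hs => by
    obtain ⟨u, hu, rfl⟩ := ht hs
    exact (hb.isOpen hu).isClosed_compl
  refine ⟨sInter '' {t | t.Finite ∧ t ⊆ compl '' b},
    (countable_ofPred_finite_subset (hbc.image _)).image _, ?_, ⟨∅, ⟨finite_empty, empty_subset _⟩, sInter_empty⟩, ?_, ?_⟩
  · rintro _ ⟨s, hs, rfl⟩ _ ⟨t, ht, rfl⟩ -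
    exact ⟨s ∪ t, ⟨hs.1.union ht.1, union_subset hs.2 ht.2⟩, sInter_union s t⟩
  · rintro _ ⟨t, ht, rfl⟩
    exact hcl t ht.2
  · apply le_antisymm
    · rw [BorelSpace.measurable_eq (α := Y), hb.borel_eq_generateFrom]
      refine MeasurableSpace.generateFrom_le fun u hu => ?_
      rw [← compl_compl u]
      have hmem : {uᶜ} ∈ {t | t.Finite ∧ t ⊆ compl '' b} :=
        ⟨finite_singleton _, singleton_subset_iff.2 (mem_image_of_mem _ hu)⟩
      rw [← sInter_singleton uᶜ]
      exact (MeasurableSpace.measurableSet_generateFrom (mem_image_of_mem sInter hmem)).compl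
    · refine MeasurableSpace.generateFrom_le ?_
      rintro _ ⟨t, ht, rfl⟩
      exact (hcl t ht.2).measurableSet

/-- Each closed set has its own exceptional null set; a countable generating `π`-system lets them be
merged into one, off which `κ` is unchanged. -/
theorem aemeasurable_measure_of_isClosed [SecondCountableTopology Y] [∀ a, IsFiniteMeasure (κ a)]
    (h : ∀ s, IsClosed s → AEMeasurable (fun a => κ a s) μ) : AEMeasurable κ μ := by
  classical
  obtain ⟨S, hS, hpi, huniv, hcl, hgen⟩ := exists_countable_piSystem_isClosed (Y := Y)
  have hae : ∀ᵐ a ∂μ, ∀ s (hs : s ∈ S), κ a s = (h s (hcl s hs)).mk _ a :=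
    (ae_ball_iff hS).2 fun s hs => (h s (hcl s hs)).ae_eq_mk
  set N := toMeasurable μ {a | ¬ ∀ s (hs : s ∈ S), κ a s = (h s (hcl s hs)).mk _ a}
  have hN : MeasurableSet N := measurableSet_toMeasurable _ _
  have hN0 : μ N = 0 := (measure_toMeasurable _).trans hae
  have hmem : ∀ a ∉ N, ∀ s (hs : s ∈ S), κ a s = (h s (hcl s hs)).mk _ a := fun a ha => by
    by_contra hc
    exact ha (subset_toMeasurable _ _ hc)
  let κ' : α → Measure Y := fun a => if a ∈ N then 0 else κ a
  have hfin : ∀ a, IsFiniteMeasure (κ' a) := fun a => by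
    by_cases ha : a ∈ N <;> simp only [κ', ha, if_true, if_false] <;> infer_instance
  have hmeas : ∀ s ∈ S, Measurable fun a => κ' a s := fun s hs => by
    have : (fun a => κ' a s) = fun a => if a ∈ N then 0 else (h s (hcl s hs)).mk _ a := by
      ext a
      by_cases ha : a ∈ N
      · simp [κ', ha]
      · simp [κ', ha, hmem a ha s hs]
    rw [this]
    exact Measurable.ite hN measurable_const (h s (hcl s hs)).measurable_mk
  refine ⟨κ', .measure_of_isPiSystem hgen hpi hmeas (hmeas _ huniv), ?_⟩
  filter_upwards [measure_eq_zero_iff_ae_notMem.1 hN0] with a ha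
  simp [κ', ha]

theorem lintegral_coe_eq_ofReal_integral (ν : Measure Y) [IsFiniteMeasure ν] (f : Y →ᵇ ℝ≥0) :
    ∫⁻ y, f y ∂ν = ENNReal.ofReal (∫ y, (f y : ℝ) ∂ν) := by
  rw [← BoundedContinuousFunction.toReal_lintegral_coe_eq_integral f,
    ENNReal.ofReal_toReal (BoundedContinuousFunction.lintegral_lt_top_of_nnreal _ f).ne]

variable [SecondCountableTopology Y] [HasOuterApproxClosed Y] [∀ a, IsFiniteMeasure (κ a)]

/-- Indicators of closed sets are pointwise limits of bounded continuous functions. -/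
theorem aemeasurable_measure_of_integral
    (h : ∀ f : C(Y, ℝ), AEMeasurable (fun a => ∫ y, f y ∂κ a) μ) : AEMeasurable κ μ := by
  refine aemeasurable_measure_of_isClosed fun s hs => ?_
  refine aemeasurable_of_tendsto_metrizable_ae (f := fun n a => ∫⁻ y, hs.apprSeq n y ∂κ a) atTop
    (fun n => ?_) (ae_of_all _ fun a => HasOuterApproxClosed.tendsto_lintegral_apprSeq hs (κ a))
  simp_rw [lintegral_coe_eq_ofReal_integral]
  exact (h ⟨fun y => (hs.apprSeq n y : ℝ), by fun_prop⟩).ennreal_ofReal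

theorem bind_eq_of_integral {ν : Measure Y} [IsFiniteMeasure ν]
    (hint : ∀ f : C(Y, ℝ), Integrable (fun a => ∫ y, f y ∂κ a) μ)
    (h : ∀ f : C(Y, ℝ), ∫ a, ∫ y, f y ∂κ a ∂μ = ∫ y, f y ∂ν) : μ.bind κ = ν := by
  symm
  apply ext_of_forall_lintegral_eq_of_IsFiniteMeasure
  intro f
  have hκ := aemeasurable_measure_of_integral fun f => (hint f).aestronglyMeasurable.aemeasurable
  let g : C(Y, ℝ) := ⟨fun y => (f y : ℝ), by fun_prop⟩
  rw [Measure.lintegral_bind hκ (by fun_prop)]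
  simp_rw [lintegral_coe_eq_ofReal_integral]
  calc ENNReal.ofReal (∫ y, g y ∂ν)
      = ENNReal.ofReal (∫ a, ∫ y, g y ∂κ a ∂μ) := by rw [h g]
    _ = ∫⁻ a, ENNReal.ofReal (∫ y, g y ∂κ a) ∂μ :=
      ofReal_integral_eq_lintegral_ofReal (hint g)
        (ae_of_all _ fun a => integral_nonneg fun y => (f y).2)

end MeasureValued

/-! ### Cesàro means. -/

theorem tendsto_cesaro_of_abs_sub {b : ℕ → ℝ} {l : ℝ}
    (h : Tendsto (fun n : ℕ => (1 / (n : ℝ)) * ∑ j ∈ Finset.range n, |b j - l|) atTop (𝓝 0)) :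
    Tendsto (fun n : ℕ => (1 / (n : ℝ)) * ∑ j ∈ Finset.range n, b j) atTop (𝓝 l) := by
  rw [tendsto_iff_norm_sub_tendsto_zero]
  refine squeeze_zero' (Eventually.of_forall fun _ => norm_nonneg _) ?_ h
  filter_upwards [eventually_gt_atTop 0] with n hn
  have hn' : (0 : ℝ) < n := by exact_mod_cast hn
  have : (1 / (n : ℝ)) * ∑ j ∈ Finset.range n, b j - l
      = (1 / (n : ℝ)) * ∑ j ∈ Finset.range n, (b j - l) := by
    rw [Finset.sum_sub_distrib, Finset.sum_const, Finset.card_range, nsmul_eq_mul]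
    field_simp
  rw [this, norm_mul, Real.norm_of_nonneg (by positivity)]
  gcongr
  exact norm_sum_le _ _

/-- Cesàro limits do not change when the sequence is shifted. -/
theorem eq_of_tendsto_cesaro_succ {b : ℕ → ℝ} {l l' : ℝ}
    (h : Tendsto (fun n : ℕ => (1 / (n : ℝ)) * ∑ j ∈ Finset.range n, b j) atTop (𝓝 l))
    (h' : Tendsto (fun n : ℕ => (1 / (n : ℝ)) * ∑ j ∈ Finset.range n, b (j + 1)) atTop (𝓝 l')) :
    l = l' := by
  have h0 : Tendsto (fun n : ℕ => 1 / ((n : ℝ) + 1)) atTop (𝓝 0) :=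
    tendsto_one_div_add_atTop_nhds_zero_nat
  have h1 := ((tendsto_const_nhds (x := (1 : ℝ))).sub h0).mul h'
  -- The mean of `n + 1` terms is `b 0 / (n + 1)` plus `1 - 1 / (n + 1)` times the shifted mean of
  -- `n` terms.
  have h2 := (h0.mul (tendsto_const_nhds (x := b 0))).add h1
  simp only [zero_mul, sub_zero, one_mul, zero_add] at h2
  refine tendsto_nhds_unique ((tendsto_add_atTop_iff_nat 1).2 h) (h2.congr' ?_)
  filter_upwards [eventually_gt_atTop 0] with n hn
  have hn' : (n : ℝ) ≠ 0 := by exact_mod_cast hn.ne'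
  rw [Finset.sum_range_succ']
  push_cast
  field_simp
  ring

/-! ### Triviality of invariant sets for an operator given by a kernel. -/

section Operator

variable {X : Type*} [MeasurableSpace X] {μ : Measure X} {κ : Kernel X X} {T : (X → ℝ) → X → ℝ}

theorem integral_measure_comp {f : X → ℝ} (hf : Integrable f (κ ∘ₘ μ)) :
    ∫ w, f w ∂(κ ∘ₘ μ) = ∫ z, ∫ w, f w ∂κ z ∂μ := by
  rw [Measure.comp_eq_comp_const_apply] at hf ⊢
  rw [Kernel.integral_comp hf, Kernel.const_apply]

theorem integrable_integral_measure_comp {f : X → ℝ} (hf : Integrable f (κ ∘ₘ μ)) :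
    Integrable (fun z => ∫ w, f w ∂κ z) μ := by
  rw [Measure.comp_eq_comp_const_apply] at hf
  simpa using hf.integral_comp

/-- This domination makes the density of `κ ∘ₘ μ.restrict B` an admissible `ψ` in weak mixing. -/
theorem comp_restrict_le (hκ : κ ∘ₘ μ = μ) (B : Set X) : κ ∘ₘ μ.restrict B ≤ μ := by
  refine Measure.le_iff.2 fun s hs => ?_
  conv_rhs => rw [← hκ]
  rw [Measure.bind_apply hs κ.aemeasurable, Measure.bind_apply hs κ.aemeasurable]
  exact lintegral_mono' Measure.restrict_le_self le_rfl

theorem setIntegral_operator (hκ : κ ∘ₘ μ = μ) (hT : ∀ f, T f =ᵐ[μ] fun z => ∫ w, f w ∂κ z)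
    {f : X → ℝ} (hf : Integrable f μ) (B : Set X) :
    ∫ z in B, T f z ∂μ = ∫ w, f w ∂(κ ∘ₘ μ.restrict B) := by
  rw [integral_congr_ae (ae_restrict_of_ae (hT f)),
    integral_measure_comp (hf.mono_measure (comp_restrict_le hκ B))]

theorem integrable_operator_iterate (hκ : κ ∘ₘ μ = μ)
    (hT : ∀ f, T f =ᵐ[μ] fun z => ∫ w, f w ∂κ z) {f : X → ℝ} (hf : Integrable f μ) (n : ℕ) :
    Integrable (T^[n] f) μ := by
  induction n with
  | zero => exact hf
  | succ n ih =>
    rw [Function.iterate_succ_apply', integrable_congr (hT _)]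
    exact integrable_integral_measure_comp (hκ.symm ▸ ih)

variable [TopologicalSpace X] [CompactSpace X] [HasOuterApproxClosed X] [BorelSpace X]
  [IsProbabilityMeasure μ]

/-- If the Cesàro means of the correlations of a positive operator given by a kernel preserving
`μ` converge as in weak mixing, then every set which the kernel does not leave is trivial. -/
theorem measure_eq_zero_or_one_of_weakMixing (hκ : κ ∘ₘ μ = μ)
    (hT : ∀ f, T f =ᵐ[μ] fun z => ∫ w, f w ∂κ z)
    (hmix : ∀ (φ : C(X, ℝ)) (ψ : X → ℝ), Integrable ψ μ →
      Tendsto (fun n : ℕ => (1 / (n : ℝ)) * ∑ j ∈ Finset.range n, ∫ z, (T^[j] φ) z * ψ z ∂μ) atTop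
        (𝓝 ((∫ z, φ z ∂μ) * ∫ z, ψ z ∂μ)))
    {B : Set X} (hB : MeasurableSet B) (hκB : ∀ᵐ z ∂μ.restrict B, κ z Bᶜ = 0) :
    μ B = 0 ∨ μ B = 1 := by
  have hint (φ : C(X, ℝ)) : Integrable φ μ :=
    φ.continuous.integrable_of_hasCompactSupport (HasCompactSupport.of_compactSpace _)
  have hset (f : X → ℝ) : ∫ z, f z * B.indicator 1 z ∂μ = ∫ z in B, f z ∂μ := by
    rw [← integral_indicator hB]
    congr with z
    by_cases hz : z ∈ B <;> simp [hz]
  have hind : Integrable (B.indicator (1 : X → ℝ)) μ := (integrable_const (1 : ℝ)).indicator hB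
  have hindB : ∫ z, B.indicator (1 : X → ℝ) z ∂μ = μ.real B := integral_indicator_one hB
  set ν : Measure X := κ ∘ₘ μ.restrict B with hν
  have hνμ : ν ≤ μ := comp_restrict_le hκ B
  have : IsFiniteMeasure ν := isFiniteMeasure_of_le μ hνμ
  -- With `φ = 1`, testing against `dν/dμ` gives the correlations against the indicator of `B`
  -- shifted by one step, so the Cesàro limits `ν(X)` and `μ(B)` agree.
  have hνuniv : ν.real univ = μ.real B := by
    have h1 := hmix 1 _ hind
    have h2 := hmix 1 (fun z => (ν.rnDeriv μ z).toReal) Measure.integrable_toReal_rnDeriv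
    have h3 (j : ℕ) : ∫ z, (T^[j] (1 : C(X, ℝ))) z * (ν.rnDeriv μ z).toReal ∂μ
        = ∫ z in B, (T^[j + 1] (1 : C(X, ℝ))) z ∂μ := by
      rw [Function.iterate_succ_apply', setIntegral_operator hκ hT
        (integrable_operator_iterate hκ hT (hint 1) j), ← hν,
        ← integral_rnDeriv_smul hνμ.absolutelyContinuous]
      simp only [smul_eq_mul, mul_comm]
    simp_rw [hset] at h1
    simp_rw [h3] at h2
    have h4 := eq_of_tendsto_cesaro_succ h1 h2
    rw [hindB, Measure.integral_toReal_rnDeriv hνμ.absolutelyContinuous] at h4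
    simpa using h4.symm
  have hνB : ν Bᶜ = 0 := by
    rw [Measure.bind_apply hB.compl κ.aemeasurable, lintegral_congr_ae hκB]
    simp
  have hνeq : ν = μ.restrict B := by
    refine Measure.eq_of_le_of_measure_univ_eq (Measure.le_iff.2 fun s hs => ?_) ?_
    · rw [Measure.restrict_apply hs, ← measure_inter_add_sdiff s hB,
        measure_mono_null (s := s \ B) (fun x hx => hx.2) hνB, add_zero]
      exact hνμ _
    · rw [Measure.restrict_apply_univ]
      exact (measureReal_eq_measureReal_iff).1 hνuniv
  have hiter (φ : C(X, ℝ)) (n : ℕ) : ∫ z in B, (T^[n] φ) z ∂μ = ∫ z in B, φ z ∂μ := by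
    induction n with
    | zero => rfl
    | succ n ih =>
      rw [Function.iterate_succ_apply', setIntegral_operator hκ hT
        (integrable_operator_iterate hκ hT (hint φ) n), ← hν, hνeq, ih]
  have hprod (φ : C(X, ℝ)) : ∫ z in B, φ z ∂μ = (∫ z, φ z ∂μ) * μ.real B := by
    have h1 := hmix φ _ hind
    simp_rw [hset, hiter, hindB] at h1
    refine tendsto_nhds_unique (tendsto_const_nhds.congr' ?_) h1
    filter_upwards [eventually_gt_atTop 0] with n hn
    have hn' : (n : ℝ) ≠ 0 := by exact_mod_cast hn.ne'
    rw [Finset.sum_const, Finset.card_range, nsmul_eq_mul]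
    field_simp
  have hmeas : μ.restrict B = (μ B) • μ := by
    have : IsFiniteMeasure (μ B • μ) := μ.smul_finite (measure_ne_top μ B)
    refine ext_of_forall_integral_eq_of_IsFiniteMeasure fun f => ?_
    rw [integral_smul_measure, smul_eq_mul, mul_comm]
    exact hprod f.toContinuousMap
  have hsq : μ B = μ B * μ B := by
    simpa using congrArg (fun m : Measure X => m B) hmeas
  by_cases h0 : μ B = 0
  · exact Or.inl h0
  · refine Or.inr ?_
    have := (ENNReal.mul_eq_left h0 (measure_ne_top μ B)).1 hsq.symm
    exact this

end Operator

/-! ### Transition measures of a correspondence. -/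

namespace HolomorphicCorrespondence

variable {k : ℕ} {X : Type*} [TopologicalSpace X] [ChartedSpace (EuclideanSpace ℂ (Fin k)) X]
  (F : HolomorphicCorrespondence k X)

theorem finite_preimage_singleton (z : X) : (F.preimage {z}).Finite := by
  have h := F.finite_preimage z
  rwa [← image_iUnion, ← inter_iUnion] at h

theorem preimageSum_eq_sum (φ : X → ℝ) (z : X) :
    F.preimageSum φ z = ∑ w ∈ (F.finite_preimage_singleton z).toFinset, (F.mult w z : ℝ) * φ w :=
  finsum_mem_eq_finite_toFinset_sum _ _

theorem preimageSum_add (φ ψ : X → ℝ) (z : X) :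
    F.preimageSum (φ + ψ) z = F.preimageSum φ z + F.preimageSum ψ z := by
  simp only [preimageSum_eq_sum, Pi.add_apply, mul_add, Finset.sum_add_distrib]

variable [MeasurableSpace X]

/-- The transition measure of the correspondence: the points of `F†(z)` carry their multiplicity
divided by the topological degree. -/
noncomputable def transition (z : X) : Measure X :=
  ∑ w ∈ (F.finite_preimage_singleton z).toFinset,
    ((F.mult w z : ℝ≥0) / F.topologicalDegree) • Measure.dirac w

instance (z : X) : IsFiniteMeasure (F.transition z) := by
  unfold transition
  infer_instance

theorem integral_transition [MeasurableSingletonClass X] (φ : X → ℝ) (z : X) :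
    ∫ w, φ w ∂F.transition z = F.koopman φ z := by
  rw [transition, integral_finsetSum_measure, koopman, preimageSum_eq_sum, Finset.mul_sum]
  · refine Finset.sum_congr rfl fun w _ => ?_
    rw [integral_smul_nnreal_measure, integral_dirac, NNReal.smul_def]
    simp
    ring
  · intro w _
    exact (integrable_dirac (by simp)).smul_measure_nnreal

theorem transition_compl_eq_zero {B : Set X} (hB : MeasurableSet B) {z : X}
    (h : F.preimage {z} ⊆ B) : F.transition z Bᶜ = 0 := by
  rw [transition, Measure.finsetSum_apply]
  refine Finset.sum_eq_zero fun w hw => ?_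
  have hw' : w ∈ B := h ((F.finite_preimage_singleton z).mem_toFinset.1 hw)
  simp [Measure.dirac_apply' _ hB.compl, hw']

variable {F} {μ : Measure X}

theorem Mixing.weaklyMixing (h : F.Mixing μ) : F.WeaklyMixing μ := by
  intro φ ψ hψ
  have h1 := (tendsto_iff_norm_sub_tendsto_zero.1 (h φ ψ hψ)).cesaro
  simpa only [one_div, Real.norm_eq_abs] using h1

theorem IsInvariant.integral_koopman (hμ : F.IsInvariant μ) (hd : F.topologicalDegree ≠ 0)
    (φ : C(X, ℝ)) : ∫ z, F.koopman φ z ∂μ = ∫ z, φ z ∂μ := by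
  have hd' : (F.topologicalDegree : ℝ) ≠ 0 := Nat.cast_ne_zero.2 hd
  simp only [koopman]
  rw [integral_const_mul, hμ φ]
  field_simp

variable [IsProbabilityMeasure μ]

/-- In degree `0` the convention `1 / 0 = 0` makes `U_F` vanish, while the correlations of `1` with
`1` must average to `1`. -/
theorem WeaklyMixing.topologicalDegree_ne_zero (h : F.WeaklyMixing μ) :
    F.topologicalDegree ≠ 0 := by
  intro hd
  have hk (j : ℕ) : F.koopman^[j + 1] (1 : C(X, ℝ)) = 0 := by
    rw [Function.iterate_succ_apply']
    ext z
    simp [koopman, hd]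
  have h1 := tendsto_cesaro_of_abs_sub (h 1 1 (integrable_const (1 : ℝ)))
  have h2 : Tendsto (fun n : ℕ => (1 / (n : ℝ)) * ∑ j ∈ Finset.range n,
      F.correlation μ (j + 1) (1 : C(X, ℝ)) 1) atTop (𝓝 0) := by
    simp only [correlation, hk]
    simp
  have := eq_of_tendsto_cesaro_succ h1 h2
  simp at this

/-- A non-integrable function has integral `0` by convention, which contradicts invariance when `∫ φ
≠ 0`. Adding a constant reduces to that case. -/
theorem IsInvariant.integrable_preimageSum [CompactSpace X] [OpensMeasurableSpace X]
    (hμ : F.IsInvariant μ) (hd : F.topologicalDegree ≠ 0) (φ : C(X, ℝ)) :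
    Integrable (F.preimageSum φ) μ := by
  have hint (φ : C(X, ℝ)) : Integrable φ μ :=
    φ.continuous.integrable_of_hasCompactSupport (HasCompactSupport.of_compactSpace _)
  have key (ψ : C(X, ℝ)) (hψ : ∫ z, ψ z ∂μ ≠ 0) : Integrable (F.preimageSum ψ) μ := by
    by_contra hc
    have h := hμ ψ
    rw [integral_undef hc] at h
    exact mul_ne_zero (Nat.cast_ne_zero.2 hd) hψ h.symm
  obtain ⟨c, hc, hc'⟩ : ∃ c : ℝ, c ≠ 0 ∧ ∫ z, φ z ∂μ + c ≠ 0 := by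
    by_cases h : ∫ z, φ z ∂μ + 1 = 0
    · exact ⟨2, two_ne_zero, fun h' => by linarith⟩
    · exact ⟨1, one_ne_zero, h⟩
  have h1 := key (ContinuousMap.const X c) (by simpa using hc)
  have h2 := key (φ + ContinuousMap.const X c) (by
    have : ∫ z, (φ + ContinuousMap.const X c) z ∂μ = ∫ z, φ z ∂μ + c := by
      simp [integral_add (hint φ) (integrable_const c)]
    rwa [this])
  refine (h2.sub h1).congr (ae_of_all _ fun z => ?_)
  simp [ContinuousMap.coe_add, preimageSum_add]

theorem WeaklyMixing.ergodic [T2Space X] [CompactSpace X] [BorelSpace X]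
    (h : F.WeaklyMixing μ) (hμ : F.IsInvariant μ) : F.Ergodic μ := by
  have : SecondCountableTopology X :=
    ChartedSpace.secondCountable_of_sigmaCompact (EuclideanSpace ℂ (Fin k)) X
  have : TopologicalSpace.MetrizableSpace X :=
    TopologicalSpace.metrizableSpace_of_t3_secondCountable X
  have hd := h.topologicalDegree_ne_zero
  have hint (φ : C(X, ℝ)) : Integrable (fun z => ∫ w, φ w ∂F.transition z) μ := by
    simp_rw [F.integral_transition]
    exact (hμ.integrable_preimageSum hd φ).const_mul _
  have hae : AEMeasurable F.transition μ :=
    aemeasurable_measure_of_integral fun φ => (hint φ).aestronglyMeasurable.aemeasurable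
  have hbind : μ.bind F.transition = μ := by
    refine bind_eq_of_integral hint fun φ => ?_
    simp_rw [F.integral_transition]
    exact hμ.integral_koopman hd φ
  -- A kernel must be measurable everywhere, so the transition measures are altered on a `μ`-null
  -- set.
  let κ : Kernel X X := ⟨hae.mk _, hae.measurable_mk⟩
  have hκ : F.transition =ᵐ[μ] κ := hae.ae_eq_mk
  have hκμ : κ ∘ₘ μ = μ := (Measure.bind_congr_right hκ).symm.trans hbind
  rintro B ⟨hB, B', hB'm, hB'B, hBB', hpre⟩
  refine measure_eq_zero_or_one_of_weakMixing (T := F.koopman) hκμ (fun f => ?_)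
    (fun φ ψ hψ => tendsto_cesaro_of_abs_sub (h φ ψ hψ)) hB ?_
  · filter_upwards [hκ] with z hz
    rw [← hz, F.integral_transition]
  -- Preimages are controlled only for points of `B'`, which fills `B` up to a null set.
  · have hrestr : B' =ᵐ[μ] B :=
      ae_eq_of_subset_of_measure_ge hB'B hBB'.le hB'm.nullMeasurableSet (measure_ne_top μ B)
    rw [← Measure.restrict_congr_set hrestr]
    filter_upwards [ae_restrict_of_ae hκ, ae_restrict_mem hB'm] with z hz hzB'
    rw [← hz]
    refine F.transition_compl_eq_zero hB (subset_trans ?_ hpre)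
    exact image_mono (inter_subset_inter_left _
      (preimage_mono (singleton_subset_iff.2 hzB')))

end HolomorphicCorrespondence

end HolCorr

theorem theorem4 {k : ℕ} {X : Type*} [TopologicalSpace X] [T2Space X] [CompactSpace X]
    [ConnectedSpace X] [ChartedSpace (EuclideanSpace ℂ (Fin k)) X]
    [IsManifold 𝓘(ℂ, EuclideanSpace ℂ (Fin k)) ω X] [MeasurableSpace X] [BorelSpace X]
    (F : HolCorr.HolomorphicCorrespondence k X) (μ : Measure X) [IsProbabilityMeasure μ]
    (hμ : F.IsInvariant μ) :
    (F.Mixing μ → F.WeaklyMixing μ) ∧ (F.WeaklyMixing μ → F.Ergodic μ) :=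
  ⟨fun h => h.weaklyMixing, fun h => h.ergodic hμ⟩
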